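/- Let $G=(V,E)$ be a finite, simple, connected, undirected graph with at least two nodes, let $m=|E|$, let $d(v)$ be the degree of $v$ in $G$, and for $S\subseteq V$ let $\mathrm{vol}(S)=\sum_{v\in S}d(v)$. Let $H(i,j)$ be the expected number of steps that the simple random walk on $G$ started at $i$ takes to visit $j$ for the first time (so $H(j,j)=0$), and let $\kappa(G)=\sum_{j\in V}\frac{d(j)}{2m}H(i,j)$ be the Kemeny constant, which is finite and does not depend on the start node $i$. Let $\Gamma$ be the set of spanning trees of $G$, fix a root $r\in V$, and for each $u\neq r$ fix an arbitrary simple path $\mathcal P_u$ from $u$ to $r$ in $G$. For $\tau\in\Gamma$ let $\mathcal P^{(\tau)}_{u\to r}$ be the unique path from $u$ to $r$ in $\tau$. Regarding paths as sets of directed edges, put $$\mathbb F^{\mathcal P_u}(\tau)=\{\tau\setminus (i,j) : (i,j)\in\mathcal P_u,\ (i,j)\in\mathcal P^{(\tau)}_{u\to r}\},\qquad \mathbb F^{\mathcal P_u'}(\tau)=\{\tau\setminus (i,j) : (i,j)\in\mathcal P_u,\ (j,i)\in\mathcal P^{(\tau)}_{u\to r}\},$$ where $\tau\setminus(i,j)$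 is $\tau$ with the undirected edge $\{i,j\}$ removed, a spanning forest with two components; write it as $T_1\cup T_2$, where $T_1$ is the node set of the component containing $r$ and $T_2$ that of the other one. Define $$f(\tau)=\sum_{u\neq r}d(u)\Bigl(\sum_{T_1\cup T_2\in\mathbb F^{\mathcal P_u}(\tau)}\mathrm{vol}(T_1)-\sum_{T_1\cup T_2\in\mathbb F^{\mathcal P_u'}(\tau)}\mathrm{vol}(T_1)\Bigr).$$ Let $\omega\ge 1$ and let $\hat\tau_1,\dots,\hat\tau_\omega$ be random spanning trees on a common probability space, each uniformly distributed on $\Gamma$. Then $$\tilde\kappa=\frac1{2m\omega}\sum_{i=1}^{\omega}f(\hat\tau_i)$$ is an unbiased estimator of $\kappa(G)$: it is integrable, $\kappa(G)$ is finite, and $\mathbb E[\tilde\kappa]=\kappa(G)=\sum_{j}\frac{d(j)}{2m}H(s,j)$ for every start node $s\in V$. -/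

import Mathlib

open MeasureTheory ProbabilityTheory
open scoped ENNReal

namespace KemenyTree

noncomputable section

section RandomWalk

/-- One step of the simple random walk on `G` from `v`: a uniformly chosen neighbour of `v`
(a vertex without neighbours is never left). -/
def stepPMF {V : Type*} [Fintype V] (G : SimpleGraph V) [DecidableRel G.Adj] (v : V) : PMF V :=
  if h : (G.neighborFinset v).Nonempty then PMF.uniformOfFinset (G.neighborFinset v) h
  else PMF.pure v

/-- The transition kernel of the simple random walk, `V` being a finite discrete space. -/
def stepKernel {V : Type*} [Fintype V] [MeasurableSpace V] [DiscreteMeasurableSpace V]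
    (G : SimpleGraph V) [DecidableRel G.Adj] : Kernel V V :=
  Kernel.ofFunOfCountable fun v => (stepPMF G v).toMeasure

instance {V : Type*} [Fintype V] [MeasurableSpace V] [DiscreteMeasurableSpace V]
    (G : SimpleGraph V) [DecidableRel G.Adj] : IsMarkovKernel (stepKernel G) :=
  ⟨fun v => PMF.toMeasure.isProbabilityMeasure (stepPMF G v)⟩

/-- The transition from the history `(x₀, …, xₙ)` to `xₙ₊₁`: it depends on `xₙ` only. -/
def historyKernel {V : Type*} [Fintype V] [MeasurableSpace V] [DiscreteMeasurableSpace V]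
    (G : SimpleGraph V) [DecidableRel G.Adj] (n : ℕ) : Kernel (Finset.Iic n → V) V :=
  (stepKernel G).comap (fun x => x ⟨n, Finset.mem_Iic.2 le_rfl⟩) (measurable_pi_apply _)

instance {V : Type*} [Fintype V] [MeasurableSpace V] [DiscreteMeasurableSpace V]
    (G : SimpleGraph V) [DecidableRel G.Adj] (n : ℕ) : IsMarkovKernel (historyKernel G n) := by
  unfold historyKernel
  infer_instance

/-- The law, on infinite trajectories `ℕ → V`, of the simple random walk on `G` started at `i`. -/
def walkLaw {V : Type*} [Fintype V] [MeasurableSpace V] [DiscreteMeasurableSpace V]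
    (G : SimpleGraph V) [DecidableRel G.Adj] (i : V) : Measure (ℕ → V) :=
  Kernel.traj (X := fun _ => V) (historyKernel G) 0 (fun _ => i)

/-- The first time at which the trajectory `x` is at `j` (`∞` if it never is). -/
def firstVisit {V : Type*} (j : V) (x : ℕ → V) : ℝ≥0∞ :=
  ⨅ (n : ℕ) (_ : x n = j), (n : ℝ≥0∞)

/-- The hitting time `H(i, j)`: the expected number of steps that the simple random walk started
at `i` needs to visit `j` for the first time. -/
def hittingTime {V : Type*} [Fintype V] (G : SimpleGraph V) [DecidableRel G.Adj] (i j : V) :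
    ℝ≥0∞ :=
  letI : MeasurableSpace V := ⊤
  ∫⁻ x, firstVisit j x ∂(walkLaw G i)

/-- The Kemeny constant `∑ j, π j * H(i, j)`, with `π j = d(j) / (2 m)`, computed from the start
vertex `i`. -/
def kemeny {V : Type*} [Fintype V] [DecidableEq V] (G : SimpleGraph V) [DecidableRel G.Adj]
    (i : V) : ℝ≥0∞ :=
  ∑ j, (G.degree j : ℝ≥0∞) / (2 * (G.edgeFinset.card : ℝ≥0∞)) * hittingTime G i j

end RandomWalk

section Trees

/-- The set of spanning trees of `G`, each a graph on all of `V`. -/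
def SpanningTree {V : Type*} (G : SimpleGraph V) : Type _ :=
  {T : SimpleGraph V // T ≤ G ∧ T.IsTree}

instance {V : Type*} (G : SimpleGraph V) : MeasurableSpace (SpanningTree G) := ⊤

/-- The directed edges of a walk, each oriented in the direction of the walk. -/
def directedEdges {V : Type*} [DecidableEq V] {G : SimpleGraph V} {u v : V} (p : G.Walk u v) :
    Finset (V × V) :=
  (p.darts.map SimpleGraph.Dart.toProd).toFinset

/-- The unique path from `u` to `r` in the spanning tree `τ`. -/
def treePath {V : Type*} {G : SimpleGraph V} (τ : SpanningTree G) (u r : V) : τ.1.Walk u r :=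
  (τ.2.2.existsUnique_path u r).choose

open scoped Classical in
/-- Forward path mapping: the 2-forests `τ \ (i, j)`, where the directed edge `(i, j)` lies on `p`
and on the path from `u` to `r` in `τ`. -/
def forwardForests {V : Type*} {G : SimpleGraph V} {u r : V} (p : G.Walk u r)
    (τ : SpanningTree G) : Finset (SimpleGraph V) :=
  {e ∈ directedEdges p | (e.1, e.2) ∈ directedEdges (treePath τ u r)}.image
    fun e => τ.1.deleteEdges {s(e.1, e.2)}

open scoped Classical in
/-- Reverse path mapping: the 2-forests `τ \ (i, j)`, where the directed edge `(i, j)` lies on `p`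
and `(j, i)` lies on the path from `u` to `r` in `τ`. -/
def reverseForests {V : Type*} {G : SimpleGraph V} {u r : V} (p : G.Walk u r)
    (τ : SpanningTree G) : Finset (SimpleGraph V) :=
  {e ∈ directedEdges p | (e.2, e.1) ∈ directedEdges (treePath τ u r)}.image
    fun e => τ.1.deleteEdges {s(e.1, e.2)}

open scoped Classical in
/-- `vol(T₁)` for the component `T₁` of the forest `F` that contains `r`: the sum of the degrees
in `G` of its vertices. -/
def rootVol {V : Type*} [Fintype V] (G : SimpleGraph V) [DecidableRel G.Adj] (r : V)
    (F : SimpleGraph V) : ℝ :=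
  ∑ v with F.Reachable r v, (G.degree v : ℝ)

/-- The contribution `f(τ)` of the spanning tree `τ`. -/
def treeValue {V : Type*} [Fintype V] [DecidableEq V] (G : SimpleGraph V) [DecidableRel G.Adj]
    (r : V) (P : ∀ u, G.Path u r) (τ : SpanningTree G) : ℝ :=
  ∑ u with u ≠ r, (G.degree u : ℝ) *
    (∑ F ∈ forwardForests (P u).1 τ, rootVol G r F -
      ∑ F ∈ reverseForests (P u).1 τ, rootVol G r F)

/-- The estimator `(1 / (2 m ω)) * ∑ i, f(τ i)` computed from `ω` spanning trees. -/
def estimator {V : Type*} [Fintype V] [DecidableEq V] (G : SimpleGraph V) [DecidableRel G.Adj]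
    (r : V) (P : ∀ u, G.Path u r) {ω : ℕ} (τ : Fin ω → SpanningTree G) : ℝ :=
  1 / (2 * (G.edgeFinset.card : ℝ) * (ω : ℝ)) * ∑ i, treeValue G r P (τ i)

end Trees

end

end KemenyTree

/-! Let N be the number of spanning trees, and let `sepVol G v u` sum vol(component of v) over the
2-forests separating v from u. The proof compares both sides with these forest sums.

Hitting times: H(v,u) = `sepVol G v u` / N (`hittingTime_eq_sepVol`). The quotient satisfies the
first-step equations (`sum_sepVol_sub`), because a 2-forest separating the ends of an edge is a
spanning tree containing that edge, with the edge deleted (`sum_spanningTree_deleteEdges`). A finite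
nonnegative solution must be the hitting time, since it is the sum of the Neumann series of the walk
killed at u (`tsum_killedStep_iterate`, `lintegral_firstVisit`). Hence 2mNκ = ∑ d(u) `sepVol G s u`,
which is the sum of vol(T₁)vol(T₂) over all 2-forests and so does not depend on s
(`sum_degree_mul_sepVol`).

Trees: fix a 2-forest F separating u from r. Each edge of the chosen path that crosses F completes F
to a tree, counted +1 when it leaves the side of u and -1 when it returns. The net number of
crossings is 1, so summing over trees gives exactly `sepVol G r u` (`sum_pathMapping`). Therefore f
averages to 2mκ over the uniform tree. -/

namespace KemenyTree

/-- The transition operator of the walk on `G` killed at `u`. -/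
noncomputable def killedStep {V : Type*} [Fintype V] [DecidableEq V] (G : SimpleGraph V)
    [DecidableRel G.Adj] (u : V) (g : V → ℝ≥0∞) (v : V) : ℝ≥0∞ :=
  if v = u then 0 else ∑ w, stepPMF G v w * g w

/-! ### Hitting times as Neumann series of the killed walk -/

section Walk

/-- The tail-sum formula, pointwise: one unit for each time up to which `u` has not been met. Both
sides are `∞` on trajectories that never meet `u`. -/
lemma firstVisit_eq_tsum {V : Type*} [DecidableEq V] (u : V) (x : ℕ → V) :
    firstVisit u x = ∑' n, (if ∀ k ≤ n, x k ≠ u then 1 else 0 : ℝ≥0∞) := by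
  by_cases hx : ∃ n, x n = u
  · have h1 : firstVisit u x = (Nat.find hx : ℝ≥0∞) := by
      refine le_antisymm (iInf₂_le (Nat.find hx) (Nat.find_spec hx)) (le_iInf₂ fun n hn => ?_)
      exact_mod_cast Nat.find_min' hx hn
    rw [h1, tsum_eq_sum (s := Finset.range (Nat.find hx))]
    · rw [Finset.sum_congr rfl (g := fun _ => 1)]
      · simp
      · intro n hn
        rw [if_pos]
        intro k hk
        exact Nat.find_min hx (hk.trans_lt (Finset.mem_range.1 hn))
    · intro n hn
      rw [if_neg]
      intro h
      exact h _ (by simpa using hn) (Nat.find_spec hx)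
  · push Not at hx
    have : firstVisit u x = ∞ := by simp [firstVisit, hx]
    rw [this]
    simp [hx]

variable {V : Type*} [Fintype V] (G : SimpleGraph V) [DecidableRel G.Adj]

section Law

variable [MeasurableSpace V] [DiscreteMeasurableSpace V]

lemma lintegral_stepKernel (g : V → ℝ≥0∞) (v : V) :
    ∫⁻ w, g w ∂(stepKernel G v) = ∑ w, stepPMF G v w * g w := by
  change ∫⁻ w, g w ∂(stepPMF G v).toMeasure = _
  rw [lintegral_fintype]
  refine Finset.sum_congr rfl fun w _ => ?_
  rw [PMF.toMeasure_apply_singleton _ _ (measurableSet_singleton w), mul_comm]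

/-- The Markov property at time `n`. It comes from the trajectory measure being built so that its
marginal up to `n + 1` is the marginal up to `n` composed with the step kernel. -/
lemma lintegral_walkLaw_succ (v : V) (n : ℕ) (A : (Finset.Iic n → V) → ℝ≥0∞) (g : V → ℝ≥0∞) :
    ∫⁻ x, A (Preorder.frestrictLe n x) * g (x (n + 1)) ∂(walkLaw G v) =
      ∫⁻ x, A (Preorder.frestrictLe n x) * ∑ w, stepPMF G (x n) w * g w ∂(walkLaw G v) := by
  have hA : Measurable A := measurable_of_finite A
  have hg : Measurable g := measurable_of_finite g
  have key := Kernel.partialTraj_compProd_eq_map_traj (X := fun _ => V)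
    (κ := historyKernel G) (Nat.zero_le n) (x₀ := fun _ => v)
  have h1 := congrArg (fun ν => ∫⁻ p, A p.1 * g p.2 ∂ν) key
  rw [Measure.lintegral_compProd (by fun_prop), lintegral_map (by fun_prop) (by fun_prop),
    ← Kernel.traj_map_frestrictLe_apply, lintegral_map (measurable_of_finite _)
      (by fun_prop)] at h1
  unfold walkLaw
  rw [← h1]
  refine lintegral_congr fun x => ?_
  refine (lintegral_const_mul (A (Preorder.frestrictLe n x)) hg).trans ?_
  congr 1
  exact (lintegral_stepKernel G g (x n))

lemma lintegral_walkLaw_zero (v : V) (g : V → ℝ≥0∞) :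
    ∫⁻ x, g (x 0) ∂(walkLaw G v) = g v := by
  have hg : Measurable g := measurable_of_finite g
  unfold walkLaw
  rw [Kernel.lintegral_traj _ (by fun_prop)]
  simp [Function.updateFinset]

end Law

variable [DecidableEq V]

lemma killedStep_mono (u : V) : Monotone (killedStep G u) := by
  intro f g h v
  unfold killedStep
  split_ifs
  · exact le_rfl
  · exact Finset.sum_le_sum fun w _ => mul_le_mul_right (h w) _

lemma killedStep_add (u : V) (f g : V → ℝ≥0∞) :
    killedStep G u (f + g) = killedStep G u f + killedStep G u g := by
  ext v
  simp only [killedStep, Pi.add_apply]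
  split_ifs <;> simp [mul_add, Finset.sum_add_distrib]

lemma killedStep_smul (u : V) (c : ℝ≥0∞) (g : V → ℝ≥0∞) :
    killedStep G u (c • g) = c • killedStep G u g := by
  ext v
  simp only [killedStep, Pi.smul_apply, smul_eq_mul]
  split_ifs
  · simp
  · rw [Finset.mul_sum]
    exact Finset.sum_congr rfl fun w _ => by ring

lemma killedStep_iterate_add (u : V) (n : ℕ) (f g : V → ℝ≥0∞) :
    (killedStep G u)^[n] (f + g) = (killedStep G u)^[n] f + (killedStep G u)^[n] g := by
  induction n generalizing f g with
  | zero => rfl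
  | succ n ih => simp only [Function.iterate_succ_apply, killedStep_add, ih]

lemma killedStep_iterate_smul (u : V) (n : ℕ) (c : ℝ≥0∞) (g : V → ℝ≥0∞) :
    (killedStep G u)^[n] (c • g) = c • (killedStep G u)^[n] g := by
  induction n generalizing g with
  | zero => rfl
  | succ n ih => simp only [Function.iterate_succ_apply, killedStep_smul, ih]

/-- A finite solution of the first-step equation is the sum of the Neumann series. -/
lemma tsum_killedStep_iterate (u : V) (e h : V → ℝ≥0∞) (hfin : ∀ v, h v ≠ ∞)
    (hu : ∀ v, e v = 0 → h v = 0) (heq : h = e + killedStep G u h) (v : V) :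
    ∑' n, (killedStep G u)^[n] e v = h v := by
  -- Unrolling the fixed-point equation `M` times leaves a remainder, which must be shown to vanish.
  have hpart : ∀ M, ∑ n ∈ Finset.range M, (killedStep G u)^[n] e v
      + (killedStep G u)^[M] h v = h v := by
    intro M
    induction M with
    | zero => simp
    | succ M ih =>
      rw [Finset.sum_range_succ, Function.iterate_succ_apply, add_assoc, ← Pi.add_apply,
        ← killedStep_iterate_add, ← heq, ih]
  have hle : ∑' n, (killedStep G u)^[n] e v ≤ h v :=
    ENNReal.tsum_le_of_sum_range_le fun M => (le_self_add.trans_eq (hpart M))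
  -- `V` is finite and `h` vanishes where `e` does, so the sum of all ratios is a finite bound. The
  -- remainder is then at most `c` times the general term of a convergent series.
  obtain ⟨c, hc, hce⟩ : ∃ c : ℝ≥0∞, c ≠ ∞ ∧ h ≤ c • e := by
    refine ⟨∑ w, h w / e w, ?_, fun w => ?_⟩
    · refine ENNReal.sum_ne_top.2 fun w _ => ?_
      by_cases hw : e w = 0
      · simp [hu w hw]
      · exact ENNReal.div_ne_top (hfin w) hw
    · by_cases hw : e w = 0
      · simp [hu w hw]
      · have hw' : e w ≠ ∞ := fun h' => hfin w (by rw [heq]; simp [h'])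
        rw [Pi.smul_apply, smul_eq_mul, ← ENNReal.div_le_iff hw hw']
        exact Finset.single_le_sum (f := fun w => h w / e w) (fun _ _ => zero_le)
          (Finset.mem_univ w)
  have hlim : Filter.Tendsto (fun n => (killedStep G u)^[n] e v) Filter.atTop (nhds 0) :=
    ENNReal.tendsto_atTop_zero_of_tsum_ne_top (ne_top_of_le_ne_top (hfin v) hle)
  have hlim2 : Filter.Tendsto (fun n => (killedStep G u)^[n] h v) Filter.atTop (nhds 0) := by
    have h1 := ENNReal.Tendsto.const_mul (a := c) hlim (Or.inr hc)
    rw [mul_zero] at h1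
    refine tendsto_of_tendsto_of_tendsto_of_le_of_le tendsto_const_nhds h1
      (fun _ => zero_le) fun n => ?_
    have := ((killedStep_mono G u).iterate n hce) v
    rwa [killedStep_iterate_smul] at this
  have hsum := (ENNReal.tendsto_nat_tsum fun n => (killedStep G u)^[n] e v).add hlim2
  simp only [hpart, add_zero] at hsum
  exact tendsto_nhds_unique hsum tendsto_const_nhds

variable [MeasurableSpace V] [DiscreteMeasurableSpace V]

/-- Avoidance is required only strictly before time `n`; time `n` itself is left to `g`. This lets
the induction replace `g` by `killedStep G u g`, whose zero at `u` records avoidance at the next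
time. -/
lemma lintegral_walkLaw_avoid (u v : V) (n : ℕ) (g : V → ℝ≥0∞) :
    ∫⁻ x, (if ∀ k < n, x k ≠ u then 1 else 0) * g (x n) ∂(walkLaw G v) =
      (killedStep G u)^[n] g v := by
  induction n generalizing g with
  | zero => simp [lintegral_walkLaw_zero]
  | succ n ih =>
    have := lintegral_walkLaw_succ G v n
      (fun z => if ∀ k : Finset.Iic n, z k ≠ u then 1 else 0) g
    rw [Function.iterate_succ_apply, ← ih]
    convert this using 1
    · refine lintegral_congr fun x => ?_
      congr 1
      simp
    · refine lintegral_congr fun x => ?_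
      unfold killedStep
      by_cases hx : x n = u
      · rw [if_pos hx, mul_zero, if_neg, zero_mul]
        intro h
        exact h ⟨n, by simp⟩ hx
      · rw [if_neg hx]
        congr 1
        refine if_congr ?_ rfl rfl
        simp only [Preorder.frestrictLe_apply, Subtype.forall, Finset.mem_Iic]
        refine ⟨fun h k hk => ?_, fun h k hk => h k hk.le⟩
        rcases hk.lt_or_eq with hk | rfl
        · exact h k hk
        · exact hx

lemma lintegral_firstVisit (u v : V) :
    ∫⁻ x, firstVisit u x ∂(walkLaw G v) =
      ∑' n, (killedStep G u)^[n] (fun w => if w = u then 0 else 1) v := by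
  simp_rw [firstVisit_eq_tsum]
  rw [lintegral_tsum]
  · congr 1 with n
    rw [← lintegral_walkLaw_avoid]
    refine lintegral_congr fun x => ?_
    by_cases hx : x n = u
    · rw [if_pos hx, mul_zero, if_neg]
      intro h
      exact h n le_rfl hx
    · rw [if_neg hx, mul_one]
      refine if_congr ?_ rfl rfl
      refine ⟨fun h k hk => h k hk.le, fun h k hk => ?_⟩
      rcases hk.lt_or_eq with hk | rfl
      · exact h k hk
      · exact hx
  · intro n
    refine Measurable.aemeasurable (Measurable.ite ?_ measurable_const measurable_const)
    have : {x : ℕ → V | ∀ k ≤ n, x k ≠ u} = ⋂ k ∈ Set.Iic n, {x | x k ≠ u} := by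
      ext; simp
    rw [this]
    refine MeasurableSet.biInter (Set.to_countable _) fun k _ => ?_
    have hk : MeasurableSet {y : V | y ≠ u} := MeasurableSet.of_discrete
    exact (measurable_pi_apply (X := fun _ : ℕ => V) k) hk

end Walk

/-- The hitting times are determined by the first-step equations, as soon as these have a
nonnegative real solution. -/
theorem hittingTime_eq_ofReal {V : Type*} [Fintype V] [DecidableEq V] (G : SimpleGraph V)
    [DecidableRel G.Adj] (u : V) (h : V → ℝ) (hnn : ∀ v, 0 ≤ h v) (hu : h u = 0)
    (hdeg : ∀ v, 0 < G.degree v)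
    (hstep : ∀ v, v ≠ u → ∑ w ∈ G.neighborFinset v, (h v - h w) = G.degree v) (v : V) :
    hittingTime G v u = ENNReal.ofReal (h v) := by
  let _ : MeasurableSpace V := ⊤
  have _ : DiscreteMeasurableSpace V := ⟨fun _ => trivial⟩
  have h1 : hittingTime G v u = _ := lintegral_firstVisit G u v
  rw [h1]
  refine tsum_killedStep_iterate G u _ (fun v => ENNReal.ofReal (h v))
    (fun _ => ENNReal.ofReal_ne_top) ?_ ?_ v
  · intro v hv
    have : v = u := by simpa using hv
    simp [this, hu]
  · ext v
    simp only [Pi.add_apply, killedStep]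
    by_cases hv : v = u
    · simp [hv, hu]
    · have hne : (G.neighborFinset v).Nonempty := by
        rw [← Finset.card_pos]
        exact hdeg v
      have hd : (0 : ℝ) < G.degree v := by exact_mod_cast hdeg v
      have hE : ((G.degree v : ℝ≥0∞))⁻¹ = ENNReal.ofReal ((G.degree v : ℝ)⁻¹) := by
        rw [ENNReal.ofReal_inv_of_pos hd, ENNReal.ofReal_natCast]
      have hs : ∑ w, stepPMF G v w * ENNReal.ofReal (h w) =
          ENNReal.ofReal (∑ w ∈ G.neighborFinset v, (G.degree v : ℝ)⁻¹ * h w) := by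
        rw [ENNReal.ofReal_sum_of_nonneg fun w _ => mul_nonneg (inv_nonneg.2 hd.le) (hnn w),
          ← Finset.sum_subset (Finset.subset_univ (G.neighborFinset v))]
        · refine Finset.sum_congr rfl fun w hw => ?_
          rw [stepPMF, dif_pos hne, PMF.uniformOfFinset_apply_of_mem _ hw,
            ENNReal.ofReal_mul (inv_nonneg.2 hd.le), ← hE, SimpleGraph.card_neighborFinset_eq_degree]
        · intro w _ hw
          rw [stepPMF, dif_pos hne, PMF.uniformOfFinset_apply_of_notMem _ hw, zero_mul]
      rw [if_neg hv, if_neg hv, hs, ← ENNReal.ofReal_one,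
        ← ENNReal.ofReal_add zero_le_one (Finset.sum_nonneg fun w _ =>
          mul_nonneg (inv_nonneg.2 hd.le) (hnn w))]
      congr 1
      have := hstep v hv
      rw [Finset.sum_sub_distrib, Finset.sum_const, SimpleGraph.card_neighborFinset_eq_degree,
        nsmul_eq_mul] at this
      rw [← Finset.mul_sum]
      field_simp
      linarith

/-! ### Two-component forests, edge deletion, and hitting times -/

section Forests

open scoped Classical

noncomputable section

/-- The indicator that `x` and `y` lie in the same component of `F`. -/
def connInd {V : Type*} (F : SimpleGraph V) (x y : V) : ℝ := if F.Reachable x y then 1 else 0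

/-- A spanning forest of `G` with exactly two components. -/
def IsTwoForest {V : Type*} (G F : SimpleGraph V) : Prop :=
  F ≤ G ∧ F.IsAcyclic ∧ ∃ a b, ¬ F.Reachable a b ∧ ∀ x, F.Reachable a x ∨ F.Reachable b x

instance {V : Type*} [Finite V] : Fintype (SimpleGraph V) := Fintype.ofFinite _

instance {V : Type*} [Finite V] (G : SimpleGraph V) : Fintype (SpanningTree G) :=
  inferInstanceAs (Fintype {T : SimpleGraph V // T ≤ G ∧ T.IsTree})

/-- The spanning forests of `G` with exactly two components. -/
def twoForests {V : Type*} [Finite V] (G : SimpleGraph V) : Finset (SimpleGraph V) :=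
  {F | IsTwoForest G F}

variable {V : Type*} {G F : SimpleGraph V}

lemma connInd_comm (x y : V) : connInd F x y = connInd F y x := by
  simp only [connInd, SimpleGraph.reachable_comm]

lemma connInd_self (x : V) : connInd F x x = 1 := by simp [connInd]

lemma connInd_congr {x y : V} (h : F.Reachable x y) (z : V) : connInd F x z = connInd F y z := by
  unfold connInd
  exact if_congr ⟨h.symm.trans, h.trans⟩ rfl rfl

lemma connInd_eq_one_sub {x y z : V} (hxy : ¬ F.Reachable x y)
    (hz : F.Reachable x z ∨ F.Reachable y z) : connInd F x z = 1 - connInd F y z := by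
  unfold connInd
  by_cases h1 : F.Reachable x z
  · have h2 : ¬ F.Reachable y z := fun h2 => hxy (h1.trans h2.symm)
    simp [h1, h2]
  · simp [h1, hz.resolve_left h1]

lemma IsTwoForest.reachable_or (hF : IsTwoForest G F) {x y : V} (hxy : ¬ F.Reachable x y) (z : V) :
    F.Reachable x z ∨ F.Reachable y z := by
  obtain ⟨-, -, a, b, -, h⟩ := hF
  rcases h x with hx | hx <;> rcases h y with hy | hy <;> rcases h z with hz | hz
  all_goals first
    | exact (hxy (hx.symm.trans hy)).elim
    | exact Or.inl (hx.symm.trans hz)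
    | exact Or.inr (hy.symm.trans hz)

lemma IsTwoForest.connInd_eq_one_sub (hF : IsTwoForest G F) {x y : V} (hxy : ¬ F.Reachable x y)
    (z : V) : connInd F x z = 1 - connInd F y z :=
  KemenyTree.connInd_eq_one_sub hxy (hF.reachable_or hxy z)

lemma not_reachable_deleteEdges {T : SimpleGraph V} (hT : T.IsTree) {i j : V} (h : T.Adj i j) :
    ¬ (T.deleteEdges {s(i, j)}).Reachable i j :=
  SimpleGraph.isBridge_iff.1 (SimpleGraph.isAcyclic_iff_forall_isBridge.1 hT.2
    ((SimpleGraph.mem_edgeSet T).2 h))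

lemma reachable_deleteEdges_or {T : SimpleGraph V} (hT : T.Connected) (i j x : V) :
    (T.deleteEdges {s(i, j)}).Reachable i x ∨ (T.deleteEdges {s(i, j)}).Reachable j x := by
  obtain ⟨p⟩ := hT.preconnected x i
  induction p with
  | nil => exact Or.inl .rfl
  | @cons a b c hab p ih =>
    by_cases he : s(a, b) = s(c, j)
    · rcases Sym2.eq_iff.1 he with ⟨rfl, rfl⟩ | ⟨rfl, rfl⟩
      · exact Or.inl .rfl
      · exact Or.inr .rfl
    · have hba : (T.deleteEdges {s(c, j)}).Reachable b a :=
        SimpleGraph.Adj.reachable (by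
          rw [SimpleGraph.deleteEdges_adj]
          exact ⟨hab.symm, by rwa [Set.mem_singleton_iff, Sym2.eq_swap]⟩)
      exact ih.imp (fun h => h.trans hba) (fun h => h.trans hba)

lemma isTwoForest_deleteEdges (τ : SpanningTree G) {i j : V} (h : τ.1.Adj i j) :
    IsTwoForest G (τ.1.deleteEdges {s(i, j)}) :=
  ⟨(SimpleGraph.deleteEdges_le _).trans τ.2.1,
    τ.2.2.2.anti (SimpleGraph.deleteEdges_le _), i, j, not_reachable_deleteEdges τ.2.2 h,
    reachable_deleteEdges_or τ.2.2.1 i j⟩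

lemma IsTwoForest.isTree_sup_edge (hF : IsTwoForest G F) {i j : V} (hij : ¬ F.Reachable i j) :
    (F ⊔ SimpleGraph.edge i j).IsTree := by
  have hne : i ≠ j := fun h => hij (h ▸ .rfl)
  refine ⟨(SimpleGraph.connected_iff_exists_forall_reachable _).2 ⟨i, fun x => ?_⟩,
    hF.2.1.sup_edge_of_not_reachable hij⟩
  rcases hF.reachable_or hij x with h | h
  · exact h.mono le_sup_left
  · refine SimpleGraph.Reachable.trans (SimpleGraph.Adj.reachable ?_) (h.mono le_sup_left)
    exact Or.inr (by simp [SimpleGraph.edge_adj, hne])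

/-- Deleting the edge `ij` is a bijection from the spanning trees of `G` that contain it to the
2-forests of `G` that separate `i` from `j`. -/
lemma sum_spanningTree_deleteEdges [Finite V] {i j : V} (hij : G.Adj i j)
    (f : SimpleGraph V → ℝ) :
    ∑ τ : SpanningTree G, (if τ.1.Adj i j then f (τ.1.deleteEdges {s(i, j)}) else 0) =
      ∑ F ∈ twoForests G, if F.Reachable i j then 0 else f F := by
  have hswap : ∀ F, (if F.Reachable i j then 0 else f F) =
      if ¬ F.Reachable i j then f F else 0 := fun F => by rw [ite_not]
  simp_rw [hswap]
  rw [← Finset.sum_filter, ← Finset.sum_filter]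
  refine Finset.sum_bij (fun τ _ => τ.1.deleteEdges {s(i, j)}) ?_ ?_ ?_ fun _ _ => rfl
  · intro τ hτ
    have hτ := (Finset.mem_filter.1 hτ).2
    simp only [twoForests, Finset.mem_filter, Finset.mem_univ, true_and]
    exact ⟨isTwoForest_deleteEdges τ hτ, not_reachable_deleteEdges τ.2.2 hτ⟩
  · intro τ hτ σ hσ h
    have hτ := (Finset.mem_filter.1 hτ).2
    have hσ := (Finset.mem_filter.1 hσ).2
    apply Subtype.ext
    ext a b
    have h' := congrArg (fun F => F.Adj a b) h
    simp only [SimpleGraph.deleteEdges_adj, Set.mem_singleton_iff, eq_iff_iff] at h'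
    by_cases he : s(a, b) = s(i, j)
    · rw [← SimpleGraph.mem_edgeSet, ← SimpleGraph.mem_edgeSet, he]
      exact ⟨fun _ => hσ, fun _ => hτ⟩
    · simpa [he] using h'
  · intro F hF
    simp only [twoForests, Finset.mem_filter, Finset.mem_univ, true_and] at hF
    obtain ⟨hF, hr⟩ := hF
    have hadj : (F ⊔ SimpleGraph.edge i j).Adj i j :=
      Or.inr (by simp [SimpleGraph.edge_adj, hij.ne])
    refine ⟨⟨F ⊔ SimpleGraph.edge i j, sup_le hF.1 ?_, hF.isTree_sup_edge hr⟩, ?_, ?_⟩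
    · intro a b hab
      rw [SimpleGraph.edge_adj] at hab
      rcases hab.1 with ⟨rfl, rfl⟩ | ⟨rfl, rfl⟩
      · exact hij
      · exact hij.symm
    · exact Finset.mem_filter.2 ⟨Finset.mem_univ _, hadj⟩
    · ext a b
      simp only [SimpleGraph.deleteEdges_adj, SimpleGraph.sup_adj, SimpleGraph.edge_adj,
        Set.mem_singleton_iff, Sym2.eq_iff]
      refine ⟨?_, fun hab => ⟨Or.inl hab, ?_⟩⟩
      · rintro ⟨h | h, h'⟩
        · exact h
        · exact (h' h.1).elim
      · rintro (⟨rfl, rfl⟩ | ⟨rfl, rfl⟩)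
        · exact hr hab.reachable
        · exact hr hab.symm.reachable

/-- In a tree, exactly one neighbour `w` of `v` leads towards a given other vertex `x`. -/
lemma existsUnique_adj_reachable_deleteEdges {T : SimpleGraph V} (hT : T.IsTree) {v x : V}
    (hx : x ≠ v) :
    ∃! w, T.Adj v w ∧ (T.deleteEdges {s(v, w)}).Reachable w x := by
  obtain ⟨p, hp, hpu⟩ := hT.existsUnique_path v x
  cases p with
  | nil => exact (hx rfl).elim
  | @cons _ w _ hvw q =>
    rw [SimpleGraph.Walk.cons_isPath_iff] at hp
    refine ⟨w, ⟨hvw, SimpleGraph.reachable_deleteEdges_iff_exists_walk.2 ⟨q, fun h =>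
      hp.2 (q.fst_mem_support_of_mem_edges h)⟩⟩, ?_⟩
    -- The path from `w'` to `x` cannot meet `v`, as `vw'` is a bridge. Prepending `v` gives a path
    -- from `v` to `x` in `T`, and that path is unique.
    rintro w' ⟨hvw', hr⟩
    have hbr := not_reachable_deleteEdges hT hvw'
    obtain ⟨q', hq'⟩ := hr.exists_isPath
    have hle : T.deleteEdges {s(v, w')} ≤ T := SimpleGraph.deleteEdges_le _
    have hv : v ∉ (q'.mapLe hle).support := by
      intro h
      rw [SimpleGraph.Walk.support_mapLe_eq_support] at h
      exact hbr (q'.takeUntil v h).reachable.symm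
    have hpath : (SimpleGraph.Walk.cons hvw' (q'.mapLe hle)).IsPath :=
      (SimpleGraph.Walk.cons_isPath_iff _ _).2 ⟨(SimpleGraph.Walk.isPath_mapLe hle).2 hq', hv⟩
    have := hpu _ hpath
    injection this

lemma nonempty_spanningTree (hG : G.Connected) : Nonempty (SpanningTree G) := by
  obtain ⟨T, hle, hT⟩ := hG.exists_isTree_le
  exact ⟨⟨T, hle, hT⟩⟩

variable [Fintype V]

/-- For `x ≠ v` exactly one tree edge at `v` has `x` on its far side; `v` itself is on the far side
of none. -/
lemma sum_adj_connInd [DecidableRel G.Adj] (τ : SpanningTree G) (v x : V) :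
    ∑ w ∈ G.neighborFinset v,
      (if τ.1.Adj v w then connInd (τ.1.deleteEdges {s(v, w)}) w x else 0) =
      if x = v then 0 else 1 := by
  have hterm : ∀ w, (if τ.1.Adj v w then connInd (τ.1.deleteEdges {s(v, w)}) w x else 0) =
      if τ.1.Adj v w ∧ (τ.1.deleteEdges {s(v, w)}).Reachable w x then 1 else 0 := by
    intro w
    unfold connInd
    split_ifs <;> simp_all
  simp_rw [hterm]
  by_cases hx : x = v
  · subst hx
    rw [if_pos rfl]
    refine Finset.sum_eq_zero fun w _ => if_neg ?_
    rintro ⟨h1, h2⟩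
    exact not_reachable_deleteEdges τ.2.2 h1 h2.symm
  · obtain ⟨w, hw, hu⟩ := existsUnique_adj_reachable_deleteEdges τ.2.2 hx
    rw [if_neg hx, Finset.sum_eq_single w]
    · rw [if_pos hw]
    · intro b _ hb
      exact if_neg fun h => hb (hu b h)
    · intro h
      exact (h ((G.mem_neighborFinset v w).2 (τ.2.1 hw.1))).elim

variable [DecidableRel G.Adj]

lemma rootVol_eq_sum (v : V) (F : SimpleGraph V) :
    rootVol G v F = ∑ x, (G.degree x : ℝ) * connInd F v x := by
  rw [rootVol, Finset.sum_filter]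
  refine Finset.sum_congr rfl fun x _ => ?_
  unfold connInd
  split_ifs <;> simp

lemma rootVol_nonneg (v : V) (F : SimpleGraph V) : 0 ≤ rootVol G v F :=
  Finset.sum_nonneg fun _ _ => Nat.cast_nonneg _

/-- The total volume, over the 2-forests that separate `v` from `u`, of the component of `v`. -/
def sepVol (G : SimpleGraph V) [DecidableRel G.Adj] (v u : V) : ℝ :=
  ∑ F ∈ twoForests G, (1 - connInd F v u) * rootVol G v F

/-- This is N times the first-step equation. Forests joining `v` and `w` cancel in the difference;
the others correspond to trees through `vw`. For a fixed tree, summing over `w` leaves the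
coefficient [u ≠ v] - [x ≠ v] = [x = v] on d(x), so each tree contributes d(v). -/
lemma sum_sepVol_sub {u v : V} (hv : v ≠ u) :
    ∑ w ∈ G.neighborFinset v, (sepVol G v u - sepVol G w u) =
      Fintype.card (SpanningTree G) * (G.degree v : ℝ) := by
  have h1 : ∀ w ∈ G.neighborFinset v, sepVol G v u - sepVol G w u =
      ∑ τ : SpanningTree G, (if τ.1.Adj v w then
        ∑ x, (G.degree x : ℝ) * (connInd (τ.1.deleteEdges {s(v, w)}) w u -
          connInd (τ.1.deleteEdges {s(v, w)}) w x) else 0) := by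
    intro w hw
    rw [sum_spanningTree_deleteEdges ((G.mem_neighborFinset v w).1 hw)
      (fun F => ∑ x, (G.degree x : ℝ) * (connInd F w u - connInd F w x)), sepVol, sepVol,
      ← Finset.sum_sub_distrib]
    refine Finset.sum_congr rfl fun F hF => ?_
    have hF : IsTwoForest G F := (Finset.mem_filter.1 hF).2
    simp only [rootVol_eq_sum, Finset.mul_sum]
    rw [← Finset.sum_sub_distrib]
    split_ifs with hr
    · refine Finset.sum_eq_zero fun x _ => ?_
      rw [connInd_congr hr, connInd_congr hr x, sub_self]
    -- With a, b the indicators of `u`, `x` on the side of `w`, the difference is a(1 - b) - (1 -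
    -- a)b = a - b.
    · refine Finset.sum_congr rfl fun x _ => ?_
      rw [hF.connInd_eq_one_sub hr u, hF.connInd_eq_one_sub hr x]
      ring
  rw [Finset.sum_congr rfl h1, Finset.sum_comm, ← nsmul_eq_mul]
  refine Finset.sum_eq_card_nsmul fun τ _ => ?_
  have h2 : ∀ w, (if τ.1.Adj v w then
        ∑ x, (G.degree x : ℝ) * (connInd (τ.1.deleteEdges {s(v, w)}) w u -
          connInd (τ.1.deleteEdges {s(v, w)}) w x) else 0) =
      ∑ x, (G.degree x : ℝ) *
        ((if τ.1.Adj v w then connInd (τ.1.deleteEdges {s(v, w)}) w u else 0) -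
          (if τ.1.Adj v w then connInd (τ.1.deleteEdges {s(v, w)}) w x else 0)) := by
    intro w
    split_ifs <;> simp
  simp_rw [h2]
  rw [Finset.sum_comm]
  simp_rw [← Finset.mul_sum, Finset.sum_sub_distrib, sum_adj_connInd]
  rw [if_neg hv.symm, Finset.sum_eq_single v]
  · simp
  · intro x _ hx
    simp [hx]
  · simp

lemma sepVol_self (u : V) : sepVol G u u = 0 :=
  Finset.sum_eq_zero fun F _ => by rw [connInd_self, sub_self, zero_mul]

lemma sepVol_nonneg (v u : V) : 0 ≤ sepVol G v u :=
  Finset.sum_nonneg fun F _ => mul_nonneg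
    (by unfold connInd; split_ifs <;> norm_num) (rootVol_nonneg v F)

/-- Hitting times as ratios of forest counts to tree counts. -/
theorem hittingTime_eq_sepVol [DecidableEq V] [Nontrivial V] (hG : G.Connected) (v u : V) :
    hittingTime G v u = ENNReal.ofReal (sepVol G v u / Fintype.card (SpanningTree G)) := by
  have := nonempty_spanningTree hG
  have hN : (0 : ℝ) < Fintype.card (SpanningTree G) := by exact_mod_cast Fintype.card_pos
  refine hittingTime_eq_ofReal G u (fun v => sepVol G v u / Fintype.card (SpanningTree G))
    (fun v => div_nonneg (sepVol_nonneg v u) hN.le) ?_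
    (fun v => hG.preconnected.degree_pos_of_nontrivial v) ?_ v
  · simp only [sepVol_self, zero_div]
  · intro v hv
    simp only [← sub_div]
    rw [← Finset.sum_div, sum_sepVol_sub hv]
    field_simp

/-- `∑ u, d(u) * sepVol v u` is the sum over the 2-forests of the product of the volumes of the two
components, whatever `v` is. -/
lemma sum_degree_mul_sepVol (v w : V) :
    ∑ u, (G.degree u : ℝ) * sepVol G v u = ∑ u, (G.degree u : ℝ) * sepVol G w u := by
  simp only [sepVol, Finset.mul_sum]
  rw [Finset.sum_comm, Finset.sum_comm (s := Finset.univ)]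
  refine Finset.sum_congr rfl fun F hF => ?_
  have hF : IsTwoForest G F := (Finset.mem_filter.1 hF).2
  have key : ∀ v, ∑ u, (G.degree u : ℝ) * ((1 - connInd F v u) * rootVol G v F) =
      (∑ u, (G.degree u : ℝ) * (1 - connInd F v u)) * ∑ u, (G.degree u : ℝ) * connInd F v u := by
    intro v
    rw [← rootVol_eq_sum, Finset.sum_mul]
    exact Finset.sum_congr rfl fun u _ => by ring
  rw [key, key]
  by_cases hr : F.Reachable v w
  · simp only [connInd_congr hr]
  · simp only [hF.connInd_eq_one_sub hr, sub_sub_cancel]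
    ring

end

end Forests

/-! ### Path mappings as signed crossings of a 2-forest -/

section PathMapping

lemma mem_directedEdges {V : Type*} [DecidableEq V] {H : SimpleGraph V} {u r i j : V}
    (p : H.Walk u r) : (i, j) ∈ directedEdges p ↔ ∃ d ∈ p.darts, d.toProd = (i, j) := by
  simp [directedEdges]

lemma adj_of_mem_directedEdges {V : Type*} [DecidableEq V] {H : SimpleGraph V} {u r i j : V}
    {p : H.Walk u r} (h : (i, j) ∈ directedEdges p) : H.Adj i j := by
  obtain ⟨d, -, hd⟩ := (mem_directedEdges p).1 h
  have := d.adj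
  rwa [hd] at this

/-- A path uses each edge at most once, so the segments before and after `ij` survive its deletion.
-/
lemma reachable_of_mem_directedEdges {V : Type*} [DecidableEq V] {H : SimpleGraph V} {u r i j : V}
    (p : H.Walk u r) (hp : p.IsPath) (h : (i, j) ∈ directedEdges p) :
    (H.deleteEdges {s(i, j)}).Reachable u i ∧ (H.deleteEdges {s(i, j)}).Reachable j r := by
  induction p with
  | nil => simp [directedEdges] at h
  | @cons a b c hab q ih =>
    rw [SimpleGraph.Walk.cons_isPath_iff] at hp
    obtain ⟨d, hd, hde⟩ := (mem_directedEdges _).1 h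
    rw [SimpleGraph.Walk.darts_cons, List.mem_cons] at hd
    rcases hd with rfl | hd
    · obtain ⟨rfl, rfl⟩ := Prod.ext_iff.1 hde
      exact ⟨.rfl, SimpleGraph.reachable_deleteEdges_iff_exists_walk.2
        ⟨q, fun h => hp.2 (q.fst_mem_support_of_mem_edges h)⟩⟩
    · obtain ⟨h1, h2⟩ := ih hp.1 ((mem_directedEdges q).2 ⟨d, hd, hde⟩)
      refine ⟨SimpleGraph.Reachable.trans (SimpleGraph.Adj.reachable ?_) h1, h2⟩
      refine SimpleGraph.deleteEdges_adj.2 ⟨hab, fun he => ?_⟩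
      have hmem : s(a, b) ∈ q.edges := by
        rw [Set.mem_singleton_iff.1 he]
        refine List.mem_map.2 ⟨d, hd, ?_⟩
        rw [SimpleGraph.Dart.edge, hde]
      exact hp.2 (q.fst_mem_support_of_mem_edges hmem)

lemma sum_directedEdges_sub {V : Type*} [DecidableEq V] {H : SimpleGraph V} {u r : V}
    (p : H.Walk u r) (hp : p.IsPath) (g : V → ℝ) :
    ∑ e ∈ directedEdges p, (g e.1 - g e.2) = g u - g r := by
  induction p with
  | nil => simp [directedEdges]
  | @cons a b c hab q ih =>
    rw [SimpleGraph.Walk.cons_isPath_iff] at hp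
    have hins : directedEdges (SimpleGraph.Walk.cons hab q) = insert (a, b) (directedEdges q) := by
      simp [directedEdges]
    have hnot : (a, b) ∉ directedEdges q := by
      intro h
      obtain ⟨d, hd, hde⟩ := (mem_directedEdges q).1 h
      have := q.dart_fst_mem_support_of_mem_darts hd
      rw [hde] at this
      exact hp.2 this
    rw [hins, Finset.sum_insert hnot, ih hp.1]
    ring

lemma treePath_isPath {V : Type*} {G : SimpleGraph V} (τ : SpanningTree G) (u r : V) :
    (treePath τ u r).IsPath :=
  (τ.2.2.existsUnique_path u r).choose_spec.1

/-- Apart from the adjacency of `i` and `j`, the right side involves `τ` only through the forest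
left after deletion. This allows sums over trees to become sums over 2-forests. -/
lemma mem_directedEdges_treePath {V : Type*} [DecidableEq V] {G : SimpleGraph V}
    (τ : SpanningTree G) (u r i j : V) :
    (i, j) ∈ directedEdges (treePath τ u r) ↔ τ.1.Adj i j ∧
      (τ.1.deleteEdges {s(i, j)}).Reachable u i ∧ (τ.1.deleteEdges {s(i, j)}).Reachable j r := by
  constructor
  · intro h
    exact ⟨adj_of_mem_directedEdges h, reachable_of_mem_directedEdges _ (treePath_isPath τ u r) h⟩
  · rintro ⟨hadj, h1, h2⟩
    have hbr := not_reachable_deleteEdges τ.2.2 hadj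
    have hmem := (treePath τ u r).mem_edges_of_not_reachable_deleteEdges
      (e := s(i, j)) fun h => hbr (h1.symm.trans (h.trans h2.symm))
    obtain ⟨d, hd, hde⟩ := List.mem_map.1 hmem
    rcases SimpleGraph.dart_edge_eq_mk'_iff.1 hde with h | h
    · exact (mem_directedEdges _).2 ⟨d, hd, h⟩
    · have h3 := (reachable_of_mem_directedEdges _ (treePath_isPath τ u r)
        ((mem_directedEdges _).2 ⟨d, hd, h⟩)).1
      rw [Sym2.eq_swap] at h3
      exact (hbr (h1.symm.trans h3)).elim

lemma eq_of_deleteEdges_eq {V : Type*} {T : SimpleGraph V} {i j k l : V} (h : T.Adj i j)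
    (heq : T.deleteEdges {s(i, j)} = T.deleteEdges {s(k, l)}) : s(i, j) = s(k, l) := by
  by_contra hne
  have : (T.deleteEdges {s(k, l)}).Adj i j := SimpleGraph.deleteEdges_adj.2 ⟨h, hne⟩
  rw [← heq] at this
  exact (SimpleGraph.deleteEdges_adj.1 this).2 rfl

lemma not_mem_directedEdges_treePath_swap {V : Type*} [DecidableEq V] {G : SimpleGraph V}
    (τ : SpanningTree G) {u r i j : V} (h : (i, j) ∈ directedEdges (treePath τ u r)) :
    (j, i) ∉ directedEdges (treePath τ u r) := by
  intro h'
  rw [mem_directedEdges_treePath] at h h'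
  rw [Sym2.eq_swap] at h'
  exact not_reachable_deleteEdges τ.2.2 h.1 (h.2.1.symm.trans h'.2.1)

open scoped Classical in
-- The forests form a set, so edges must give distinct ones: equal forests force equal undirected
-- edges, and a tree path never uses both orientations.
lemma sum_forwardForests {V : Type*} [Fintype V] {G : SimpleGraph V} {u r : V} (p : G.Walk u r)
    (τ : SpanningTree G) (f : SimpleGraph V → ℝ) :
    ∑ F ∈ forwardForests p τ, f F = ∑ e ∈ directedEdges p, if τ.1.Adj e.1 e.2 then
      f (τ.1.deleteEdges {s(e.1, e.2)}) * (connInd (τ.1.deleteEdges {s(e.1, e.2)}) u e.1 *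
        connInd (τ.1.deleteEdges {s(e.1, e.2)}) e.2 r) else 0 := by
  rw [forwardForests, Finset.sum_image, Finset.sum_filter]
  · refine Finset.sum_congr rfl fun e _ => ?_
    have hmem := mem_directedEdges_treePath τ u r e.1 e.2
    unfold connInd
    split_ifs <;> simp_all
  · rintro ⟨i, j⟩ h ⟨k, l⟩ h' heq
    have h1 := (Finset.mem_filter.1 h).2
    have h2 := (Finset.mem_filter.1 h').2
    rcases Sym2.eq_iff.1 (eq_of_deleteEdges_eq (adj_of_mem_directedEdges h1) heq) with
      ⟨rfl, rfl⟩ | ⟨rfl, rfl⟩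
    · rfl
    · exact (not_mem_directedEdges_treePath_swap τ h1 h2).elim

open scoped Classical in
lemma sum_reverseForests {V : Type*} [Fintype V] {G : SimpleGraph V} {u r : V} (p : G.Walk u r)
    (τ : SpanningTree G) (f : SimpleGraph V → ℝ) :
    ∑ F ∈ reverseForests p τ, f F = ∑ e ∈ directedEdges p, if τ.1.Adj e.1 e.2 then
      f (τ.1.deleteEdges {s(e.1, e.2)}) * (connInd (τ.1.deleteEdges {s(e.1, e.2)}) u e.2 *
        connInd (τ.1.deleteEdges {s(e.1, e.2)}) e.1 r) else 0 := by
  rw [reverseForests, Finset.sum_image, Finset.sum_filter]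
  · refine Finset.sum_congr rfl fun e _ => ?_
    have hmem := mem_directedEdges_treePath τ u r e.2 e.1
    rw [Sym2.eq_swap, SimpleGraph.adj_comm] at hmem
    unfold connInd
    split_ifs <;> simp_all
  · rintro ⟨i, j⟩ h ⟨k, l⟩ h' heq
    have h1 := (Finset.mem_filter.1 h).2
    have h2 := (Finset.mem_filter.1 h').2
    rcases Sym2.eq_iff.1 (eq_of_deleteEdges_eq (adj_of_mem_directedEdges h1).symm heq) with
      ⟨rfl, rfl⟩ | ⟨rfl, rfl⟩
    · rfl
    · exact (not_mem_directedEdges_treePath_swap τ h1 h2).elim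

/-- Summed over all spanning trees, the path mappings count every 2-forest that separates `u`
from `r` exactly once. -/
lemma sum_pathMapping {V : Type*} [Fintype V] {G : SimpleGraph V} [DecidableRel G.Adj] {u r : V}
    (p : G.Walk u r) (hp : p.IsPath) :
    ∑ τ : SpanningTree G, (∑ F ∈ forwardForests p τ, rootVol G r F -
      ∑ F ∈ reverseForests p τ, rootVol G r F) = sepVol G r u := by
  classical
  have h1 : ∀ τ : SpanningTree G, ∑ F ∈ forwardForests p τ, rootVol G r F -
      ∑ F ∈ reverseForests p τ, rootVol G r F =
      ∑ e ∈ directedEdges p, if τ.1.Adj e.1 e.2 then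
        (fun F => rootVol G r F * (connInd F u e.1 * connInd F e.2 r -
          connInd F u e.2 * connInd F e.1 r)) (τ.1.deleteEdges {s(e.1, e.2)}) else 0 := by
    intro τ
    rw [sum_forwardForests, sum_reverseForests, ← Finset.sum_sub_distrib]
    refine Finset.sum_congr rfl fun e _ => ?_
    split_ifs
    · ring
    · simp
  have h2 : ∀ e ∈ directedEdges p, ∑ τ : SpanningTree G, (if τ.1.Adj e.1 e.2 then
        (fun F => rootVol G r F * (connInd F u e.1 * connInd F e.2 r -
          connInd F u e.2 * connInd F e.1 r)) (τ.1.deleteEdges {s(e.1, e.2)}) else 0) =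
      ∑ F ∈ twoForests G, rootVol G r F * (1 - connInd F u r) *
        (connInd F u e.1 - connInd F u e.2) := by
    rintro ⟨i, j⟩ he
    rw [sum_spanningTree_deleteEdges (adj_of_mem_directedEdges he) (fun F => rootVol G r F *
      (connInd F u i * connInd F j r - connInd F u j * connInd F i r))]
    refine Finset.sum_congr rfl fun F hF => ?_
    have hF : IsTwoForest G F := (Finset.mem_filter.1 hF).2
    split_ifs with hij
    · rw [connInd_comm u i, connInd_comm u j, connInd_congr hij, sub_self, mul_zero]
    -- If `F` joins `u` and `r`, both sides vanish. Otherwise, with a, b the indicators of `i`, `j`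
    -- on the side of `u`, the bracket is a(1 - b) - b(1 - a) = a - b.
    · by_cases hur : F.Reachable u r
      · rw [connInd_comm j r, connInd_comm i r, ← connInd_congr hur, ← connInd_congr hur,
          connInd_congr hur r, connInd_self]
        ring
      · have hr : connInd F u r = 0 := if_neg hur
        rw [connInd_comm j r, connInd_comm i r, hF.connInd_eq_one_sub hur i,
          hF.connInd_eq_one_sub hur j, hr]
        ring
  simp_rw [h1]
  rw [Finset.sum_comm, Finset.sum_congr rfl h2, Finset.sum_comm, sepVol]
  refine Finset.sum_congr rfl fun F _ => ?_
  -- The signed crossings telescope to 1 - `connInd F u r`. This factor then appears squared, which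
  -- is harmless as it is 0 or 1.
  rw [← Finset.mul_sum, sum_directedEdges_sub p hp (fun x => connInd F u x), connInd_self,
    connInd_comm r u]
  unfold connInd
  split_ifs <;> simp

lemma sum_treeValue {V : Type*} [Fintype V] [DecidableEq V] (G : SimpleGraph V)
    [DecidableRel G.Adj] (r : V) (P : ∀ u, G.Path u r) :
    ∑ τ : SpanningTree G, treeValue G r P τ = ∑ u, (G.degree u : ℝ) * sepVol G r u := by
  simp only [treeValue]
  rw [Finset.sum_comm, Finset.sum_filter]
  refine Finset.sum_congr rfl fun u _ => ?_
  by_cases hu : u = r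
  · subst hu
    simp [sepVol_self]
  · rw [if_pos hu, ← Finset.mul_sum, sum_pathMapping _ (P u).2]

end PathMapping

/-! ### Averaging over uniform spanning trees -/

section Expectation

lemma kemeny_eq_ofReal {V : Type*} [Fintype V] [DecidableEq V] [Nontrivial V] (G : SimpleGraph V)
    [DecidableRel G.Adj] (hG : G.Connected) (s : V) :
    kemeny G s = ENNReal.ofReal ((∑ u, (G.degree u : ℝ) * sepVol G s u) /
      (2 * (G.edgeFinset.card : ℝ) * Fintype.card (SpanningTree G))) := by
  have hm : (0 : ℝ) < 2 * (G.edgeFinset.card : ℝ) := by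
    obtain ⟨w, hw⟩ := hG.preconnected.exists_adj_of_nontrivial s
    have : 0 < G.edgeFinset.card :=
      Finset.card_pos.2 ⟨s(s, w), SimpleGraph.mem_edgeFinset.2 hw⟩
    positivity
  have hmE : (2 * (G.edgeFinset.card : ℝ≥0∞)) = ENNReal.ofReal (2 * (G.edgeFinset.card : ℝ)) := by
    rw [ENNReal.ofReal_mul zero_le_two, ENNReal.ofReal_natCast, ENNReal.ofReal_ofNat]
  rw [kemeny, Finset.sum_div, ENNReal.ofReal_sum_of_nonneg fun u _ => div_nonneg
    (mul_nonneg (Nat.cast_nonneg _) (sepVol_nonneg s u)) (mul_nonneg hm.le (Nat.cast_nonneg _))]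
  refine Finset.sum_congr rfl fun u _ => ?_
  rw [hittingTime_eq_sepVol hG, hmE, ← ENNReal.ofReal_natCast, ← ENNReal.ofReal_div_of_pos hm,
    ← ENNReal.ofReal_mul (div_nonneg (Nat.cast_nonneg _) hm.le), div_mul_div_comm]

instance {V : Type*} (G : SimpleGraph V) : DiscreteMeasurableSpace (SpanningTree G) :=
  ⟨fun _ => trivial⟩

lemma integral_uniformOn_univ {α : Type*} [Fintype α] [MeasurableSpace α]
    [MeasurableSingletonClass α] [Nonempty α] (f : α → ℝ) :
    ∫ a, f a ∂(uniformOn (Set.univ : Set α)) = (∑ a, f a) / Fintype.card α := by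
  rw [integral_fintype (.of_finite), Finset.sum_div]
  refine Finset.sum_congr rfl fun a _ => ?_
  rw [measureReal_def, uniformOn_univ, Measure.count_singleton]
  simp [div_eq_inv_mul]

end Expectation

end KemenyTree

theorem mainTheorem3 {V : Type*} [Fintype V] [DecidableEq V] [Nontrivial V]
    (G : SimpleGraph V) [DecidableRel G.Adj] (hG : G.Connected)
    (r : V) (P : ∀ u, G.Path u r) (ω : ℕ) (hω : 0 < ω)
    {Ω : Type*} [MeasurableSpace Ω] (μ : Measure Ω) [IsProbabilityMeasure μ]
    (τ : Fin ω → Ω → KemenyTree.SpanningTree G)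
    (hτ : ∀ i, HasLaw (τ i) (uniformOn Set.univ) μ) :
    Integrable (fun x => KemenyTree.estimator G r P (fun i => τ i x)) μ ∧
      ∀ s : V, KemenyTree.kemeny G s ≠ ∞ ∧
        ∫ x, KemenyTree.estimator G r P (fun i => τ i x) ∂μ = (KemenyTree.kemeny G s).toReal := by
  have := KemenyTree.nonempty_spanningTree hG
  have hint : ∀ i, Integrable (fun x => KemenyTree.treeValue G r P (τ i x)) μ := fun i => by
    refine Integrable.comp_aemeasurable (g := KemenyTree.treeValue G r P) ?_ (hτ i).aemeasurable
    rw [(hτ i).map_eq]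
    exact .of_finite
  -- Only the law of each single tree enters; linearity of the integral does the rest.
  have hexp : ∀ i, ∫ x, KemenyTree.treeValue G r P (τ i x) ∂μ =
      (∑ u, (G.degree u : ℝ) * KemenyTree.sepVol G r u) /
        Fintype.card (KemenyTree.SpanningTree G) := fun i => by
    rw [← KemenyTree.sum_treeValue G r P, ← KemenyTree.integral_uniformOn_univ]
    exact (hτ i).integral_comp (f := KemenyTree.treeValue G r P)
      (measurable_of_finite _).aestronglyMeasurable
  unfold KemenyTree.estimator
  refine ⟨(integrable_finsetSum _ fun i _ => hint i).const_mul _, fun s => ?_⟩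
  rw [KemenyTree.kemeny_eq_ofReal G hG s]
  refine ⟨ENNReal.ofReal_ne_top, ?_⟩
  -- The tree side is rooted at `r` and the Kemeny constant starts at `s`; `sum_degree_mul_sepVol`
  -- identifies the two.
  rw [ENNReal.toReal_ofReal (div_nonneg (Finset.sum_nonneg fun u _ =>
    mul_nonneg (Nat.cast_nonneg _) (KemenyTree.sepVol_nonneg s u)) (by positivity)),
    integral_const_mul, integral_finsetSum _ fun i _ => hint i,
    Finset.sum_congr rfl fun i _ => hexp i, KemenyTree.sum_degree_mul_sepVol s r]
  have hω' : (ω : ℝ) ≠ 0 := by exact_mod_cast hω.ne'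
  rw [Finset.sum_const, Finset.card_univ, Fintype.card_fin, nsmul_eq_mul,
    mul_comm (2 * _ : ℝ) (ω : ℝ), one_div_mul_eq_div, mul_div_mul_left _ _ hω', div_div,
    mul_comm (Fintype.card _ : ℝ)]
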